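/- Let $P$ be a set of propositional letters. Formulas over $P$ are generated from the letters in $P$ by $\top,\bot,\wedge,\vee,\Box,\Diamond$ (there is no negation or implication). A consequence pair is an expression $\phi\trianglelefteq\psi$ with $\phi,\psi$ formulas. For a set $\Gamma$ of consequence pairs, the weak positive modal logic $\mathcal L(\Gamma)$ is the smallest set of consequence pairs that contains $\Gamma$, is closed under uniform substitution, contains all pairs $$\phi\trianglelefteq\top,\quad \bot\trianglelefteq\phi,\quad \phi\trianglelefteq\phi,\quad \phi\wedge\psi\trianglelefteq\phi,\quad \phi\wedge\psi\trianglelefteq\psi,\quad \phi\trianglelefteq\phi\vee\psi,\quad \psi\trianglelefteq\phi\vee\psi,$$ $$\top\trianglelefteq\Box\top,\quad \top\trianglelefteq\Diamond\top,\quad \Box\phi\wedge\Box\psi\trianglelefteq\Box(\phi\wedge\psi),\quad \Diamond\phi\wedge\Box\psi\trianglelefteq\Diamond(\phi\wedge\psi),$$ and is closed under the rules: from $\phi\trianglelefteq\psi$ and $\psi\trianglelefteq\chi$ infer $\phi\trianglelefteq\chi$; from $\phi\trianglelefteq\psi$ and $\phi\trianglelefteq\chi$ infer $\phi\trianglelefteq\psi\wedge\chi$;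 from $\phi\trianglelefteq\chi$ and $\psi\trianglelefteq\chi$ infer $\phi\vee\psi\trianglelefteq\chi$; from $\phi\trianglelefteq\psi$ infer $\Box\phi\trianglelefteq\Box\psi$ and $\Diamond\phi\trianglelefteq\Diamond\psi$. Write $\phi\vdash_\Gamma\psi$ if $\phi\trianglelefteq\psi\in\mathcal L(\Gamma)$. $\mathcal L(\Gamma)$ has the Craig interpolation property if for all pairwise disjoint sets $\overline p,\overline q,\overline r\subseteq P$ and all formulas $\phi$ with letters in $\overline p\cup\overline q$ and $\psi$ with letters in $\overline p\cup\overline r$ such that $\phi\vdash_\Gamma\psi$, there is a formula $\chi$ with letters in $\overline p$ such that $\phi\vdash_\Gamma\chi$ and $\chi\vdash_\Gamma\psi$. For a letter $p\in P$, consider the axioms - $\mathsf T$: $\Box p\trianglelefteq p$ and $p\trianglelefteq\Diamond p$; - $\mathsf 4$: $\Box p\trianglelefteq\Box\Box p$ and $\Diamond\Diamond p\trianglelefteq\Diamond p$; - $\mathsf B$: $p\trianglelefteq\Box\Diamond p$ and $\Diamond\Box p\trianglelefteq p$; - $\mathsf 5$: $\Diamond p\trianglelefteq\Box\Diamond p$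 and $\Diamond\Box p\trianglelefteq\Box p$; - $\mathsf{.2}$: $\Diamond\Box p\trianglelefteq\Box\Diamond p$. **Theorem.** For every $\Gamma\subseteq\{\mathsf T,\mathsf 4,\mathsf B,\mathsf 5,\mathsf{.2}\}$, the logic $\mathcal L(\Gamma)$ has the Craig interpolation property. In particular this holds for the Church–Rosser logic $\mathcal L(\{\mathsf{.2}\})$. In contrast, over any infinite set of letters, the classical modal logic $\mathsf{K.2}$ (the smallest normal modal logic containing $\Diamond\Box p\to\Box\Diamond p$) lacks the Craig interpolation property: there are pairwise disjoint sets of letters $\overline p,\overline q,\overline r$ and classical modal formulas $\phi$ with letters in $\overline p\cup\overline q$ and $\psi$ with letters in $\overline p\cup\overline r$ such that $\phi\to\psi\in\mathsf{K.2}$, but no formula $\chi$ with letters in $\overline p$ satisfies $\phi\to\chi\in\mathsf{K.2}$ and $\chi\to\psi\in\mathsf{K.2}$. -/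

import Mathlib

namespace WeakPositive

/-- Formulas of the language of modal lattices over a set `P` of propositional letters. -/
inductive Fm (P : Type*) where
  | var : P → Fm P
  | top : Fm P
  | bot : Fm P
  | and : Fm P → Fm P → Fm P
  | or : Fm P → Fm P → Fm P
  | box : Fm P → Fm P
  | dia : Fm P → Fm P

namespace Fm

/-- The set of propositional letters occurring in a formula. -/
def vars {P : Type*} : Fm P → Set P
  | var p => {p}
  | top => ∅
  | bot => ∅
  | and φ ψ => φ.vars ∪ ψ.vars
  | or φ ψ => φ.vars ∪ ψ.vars
  | box φ => φ.vars
  | dia φ => φ.vars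

/-- Uniform substitution. -/
def subst {P : Type*} (σ : P → Fm P) : Fm P → Fm P
  | var p => σ p
  | top => top
  | bot => bot
  | and φ ψ => and (φ.subst σ) (ψ.subst σ)
  | or φ ψ => or (φ.subst σ) (ψ.subst σ)
  | box φ => box (φ.subst σ)
  | dia φ => dia (φ.subst σ)

/-- The formulas all of whose letters belong to `S`. -/
def formulasOver {P : Type*} (S : Set P) : Set (Fm P) := {φ | φ.vars ⊆ S}

end Fm

/-- A consequence pair `lhs ⊴ rhs`. -/
structure Pair (P : Type*) where
  lhs : Fm P
  rhs : Fm P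

/-- `Derives Γ φ ψ` : the pair `φ ⊴ ψ` is derivable from the set `Γ` of consequence pairs by
the axioms and rules of weak positive modal logic and uniform substitution. -/
inductive Derives {P : Type*} (Γ : Set (Pair P)) : Fm P → Fm P → Prop where
  | ax {π : Pair P} : π ∈ Γ → Derives Γ π.lhs π.rhs
  | subst (σ : P → Fm P) {φ ψ : Fm P} : Derives Γ φ ψ → Derives Γ (φ.subst σ) (ψ.subst σ)
  | le_top (φ : Fm P) : Derives Γ φ .top
  | bot_le (φ : Fm P) : Derives Γ .bot φ
  | refl (φ : Fm P) : Derives Γ φ φ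
  | trans {φ ψ χ : Fm P} : Derives Γ φ ψ → Derives Γ ψ χ → Derives Γ φ χ
  | and_left (φ ψ : Fm P) : Derives Γ (.and φ ψ) φ
  | and_right (φ ψ : Fm P) : Derives Γ (.and φ ψ) ψ
  | or_left (φ ψ : Fm P) : Derives Γ φ (.or φ ψ)
  | or_right (φ ψ : Fm P) : Derives Γ ψ (.or φ ψ)
  | le_and {φ ψ χ : Fm P} : Derives Γ φ ψ → Derives Γ φ χ → Derives Γ φ (.and ψ χ)
  | or_le {φ ψ χ : Fm P} : Derives Γ φ χ → Derives Γ ψ χ → Derives Γ (.or φ ψ) χ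
  | box_top : Derives Γ .top (.box .top)
  | dia_top : Derives Γ .top (.dia .top)
  | box_mono {φ ψ : Fm P} : Derives Γ φ ψ → Derives Γ (.box φ) (.box ψ)
  | dia_mono {φ ψ : Fm P} : Derives Γ φ ψ → Derives Γ (.dia φ) (.dia ψ)
  | linearity (φ ψ : Fm P) : Derives Γ (.and (.box φ) (.box ψ)) (.box (.and φ ψ))
  | duality (φ ψ : Fm P) : Derives Γ (.and (.dia φ) (.box ψ)) (.dia (.and φ ψ))

/-- The weak positive modal logic axiomatized by `Γ`: the smallest set of consequence pairs that
contains `Γ` and is closed under uniform substitution and the axioms and rules. -/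
def logic {P : Type*} (Γ : Set (Pair P)) : Set (Pair P) := {π | Derives Γ π.lhs π.rhs}

/-- The Craig interpolation property for a set of consequence pairs. -/
def CraigInterpolation {P : Type*} (L : Set (Pair P)) : Prop :=
  ∀ p q r : Set P, Disjoint p q → Disjoint p r → Disjoint q r →
    ∀ φ ∈ Fm.formulasOver (p ∪ q), ∀ ψ ∈ Fm.formulasOver (p ∪ r), ⟨φ, ψ⟩ ∈ L →
      ∃ χ ∈ Fm.formulasOver p, ⟨φ, χ⟩ ∈ L ∧ ⟨χ, ψ⟩ ∈ L

/-- Names of the axioms T, 4, B, 5 and .2. -/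
inductive AxiomName where
  | T
  | four
  | B
  | five
  | dot2

open Fm in
/-- The consequence pairs which make up each axiom, written with the letter `p`. -/
def AxiomName.pairs {P : Type*} (p : P) : AxiomName → Set (Pair P)
  | T => {⟨box (var p), var p⟩, ⟨var p, dia (var p)⟩}
  | four => {⟨box (var p), box (box (var p))⟩, ⟨dia (dia (var p)), dia (var p)⟩}
  | B => {⟨var p, box (dia (var p))⟩, ⟨dia (box (var p)), var p⟩}
  | five => {⟨dia (var p), box (dia (var p))⟩, ⟨dia (box (var p)), box (var p)⟩}
  | dot2 => {⟨dia (box (var p)), box (dia (var p))⟩}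

end WeakPositive

namespace ClassicalModal

/-- Formulas of classical modal logic over a set `P` of propositional letters, with primitive
connectives `⊥`, `→`, `□`. -/
inductive Fm (P : Type*) where
  | var : P → Fm P
  | bot : Fm P
  | imp : Fm P → Fm P → Fm P
  | box : Fm P → Fm P

namespace Fm

/-- Classical negation. -/
def neg {P : Type*} (φ : Fm P) : Fm P := imp φ bot

/-- `◇φ` is `¬□¬φ`. -/
def dia {P : Type*} (φ : Fm P) : Fm P := neg (box (neg φ))

/-- The set of propositional letters occurring in a formula. -/
def vars {P : Type*} : Fm P → Set P
  | var p => {p}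
  | bot => ∅
  | imp φ ψ => φ.vars ∪ ψ.vars
  | box φ => φ.vars

/-- Uniform substitution. -/
def subst {P : Type*} (σ : P → Fm P) : Fm P → Fm P
  | var p => σ p
  | bot => bot
  | imp φ ψ => imp (φ.subst σ) (ψ.subst σ)
  | box φ => box (φ.subst σ)

/-- The formulas all of whose letters belong to `S`. -/
def formulasOver {P : Type*} (S : Set P) : Set (Fm P) := {φ | φ.vars ⊆ S}

end Fm

/-- Derivability in the smallest normal modal logic containing `Γ`. The constructors `weak`,
`distr` and `dne`, with modus ponens, axiomatize classical propositional logic. -/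
inductive Derives {P : Type*} (Γ : Set (Fm P)) : Fm P → Prop where
  | ax {φ : Fm P} : φ ∈ Γ → Derives Γ φ
  | subst (σ : P → Fm P) {φ : Fm P} : Derives Γ φ → Derives Γ (φ.subst σ)
  | weak (φ ψ : Fm P) : Derives Γ (.imp φ (.imp ψ φ))
  | distr (φ ψ χ : Fm P) :
      Derives Γ (.imp (.imp φ (.imp ψ χ)) (.imp (.imp φ ψ) (.imp φ χ)))
  | dne (φ : Fm P) : Derives Γ (.imp (.neg (.neg φ)) φ)
  | mp {φ ψ : Fm P} : Derives Γ (.imp φ ψ) → Derives Γ φ → Derives Γ ψ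
  | boxK (φ ψ : Fm P) : Derives Γ (.imp (.box (.imp φ ψ)) (.imp (.box φ) (.box ψ)))
  | nec {φ : Fm P} : Derives Γ φ → Derives Γ (.box φ)

/-- The smallest normal modal logic containing `Γ`. -/
def logic {P : Type*} (Γ : Set (Fm P)) : Set (Fm P) := {φ | Derives Γ φ}

/-- The modal logic K.2, axiomatized by `◇□p → □◇p`. -/
def K2 {P : Type*} (p : P) : Set (Fm P) :=
  logic {.imp (.dia (.box (.var p))) (.box (.dia (.var p)))}

/-- The Craig interpolation property for a set of classical modal formulas. -/
def CraigInterpolation {P : Type*} (L : Set (Fm P)) : Prop :=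
  ∀ p q r : Set P, Disjoint p q → Disjoint p r → Disjoint q r →
    ∀ φ ∈ Fm.formulasOver (p ∪ q), ∀ ψ ∈ Fm.formulasOver (p ∪ r), Fm.imp φ ψ ∈ L →
      ∃ χ ∈ Fm.formulasOver p, Fm.imp φ χ ∈ L ∧ Fm.imp χ ψ ∈ L

end ClassicalModal

/-! ### Interpolation for weak positive modal logics. -/

namespace WeakPositive

variable {P : Type*} {Γ : Set (Pair P)}

/-! Positive formulas are monotone in every letter. Hence substituting `⊤` for the private letters
of the antecedent `φ` weakens it (`Derives.le_subst`), while the same substitution applied to `φ ⊴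
ψ` leaves `ψ` fixed; so the substituted `φ` is an interpolant. Only monotonicity and closure under
substitution matter, whatever the axioms.

Negation breaks this. K.2 is the logic of confluent frames (`sat_of_mem_K2`, `mem_K2_of_sat`).
`meeting a b c` makes every successor a `□a`- or a `□b`-point, with both kinds present; by
confluence two of these have a common successor, where `c` holds. Two such formulas, over disjoint
pairs of letters and with `c` equal to `s` and to `¬s`, contradict each other
(`meeting_imp_mem_K2`). Yet each is true at the root of one finite confluent frame, under valuations
that are bisimilar with respect to `s`, so no formula in `s` alone separates them. -/

theorem Derives.and_mono {φ φ' ψ ψ' : Fm P} (h : Derives Γ φ φ') (h' : Derives Γ ψ ψ') :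
    Derives Γ (.and φ ψ) (.and φ' ψ') :=
  .le_and (.trans (.and_left _ _) h) (.trans (.and_right _ _) h')

theorem Derives.or_mono {φ φ' ψ ψ' : Fm P} (h : Derives Γ φ φ') (h' : Derives Γ ψ ψ') :
    Derives Γ (.or φ ψ) (.or φ' ψ') :=
  .or_le (.trans h (.or_left _ _)) (.trans h' (.or_right _ _))

/-- Formulas are monotone in their letters: a substitution that weakens every letter weakens
every formula. -/
theorem Derives.le_subst {σ : P → Fm P} (hσ : ∀ s, Derives Γ (.var s) (σ s)) :
    ∀ φ : Fm P, Derives Γ φ (φ.subst σ)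
  | .var s => hσ s
  | .top => .refl _
  | .bot => .refl _
  | .and φ ψ => .and_mono (le_subst hσ φ) (le_subst hσ ψ)
  | .or φ ψ => .or_mono (le_subst hσ φ) (le_subst hσ ψ)
  | .box φ => .box_mono (le_subst hσ φ)
  | .dia φ => .dia_mono (le_subst hσ φ)

theorem Fm.subst_eq_self {σ : P → Fm P} :
    ∀ φ : Fm P, (∀ s ∈ φ.vars, σ s = .var s) → φ.subst σ = φ
  | .var s, h => h s rfl
  | .top, _ => rfl
  | .bot, _ => rfl
  | .and φ ψ, h => by
    simp only [Fm.subst, subst_eq_self φ fun s hs => h s (.inl hs),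
      subst_eq_self ψ fun s hs => h s (.inr hs)]
  | .or φ ψ, h => by
    simp only [Fm.subst, subst_eq_self φ fun s hs => h s (.inl hs),
      subst_eq_self ψ fun s hs => h s (.inr hs)]
  | .box φ, h => by simp only [Fm.subst, subst_eq_self φ h]
  | .dia φ, h => by simp only [Fm.subst, subst_eq_self φ h]

theorem Fm.vars_subst_subset {σ : P → Fm P} {S : Set P} :
    ∀ φ : Fm P, (∀ s ∈ φ.vars, (σ s).vars ⊆ S) → (φ.subst σ).vars ⊆ S
  | .var s, h => h s rfl
  | .top, _ => Set.empty_subset _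
  | .bot, _ => Set.empty_subset _
  | .and φ ψ, h => Set.union_subset (vars_subst_subset φ fun s hs => h s (.inl hs))
      (vars_subst_subset ψ fun s hs => h s (.inr hs))
  | .or φ ψ, h => Set.union_subset (vars_subst_subset φ fun s hs => h s (.inl hs))
      (vars_subst_subset ψ fun s hs => h s (.inr hs))
  | .box φ, h => vars_subst_subset φ h
  | .dia φ, h => vars_subst_subset φ h

open Classical in
/-- Replacing the letters outside the common language by `⊤` in the antecedent gives an
interpolant. -/
theorem craigInterpolation_logic (Γ : Set (Pair P)) : CraigInterpolation (logic Γ) := by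
  intro p q r hpq _ hqr φ hφ ψ hψ h
  let σ : P → Fm P := fun s => if s ∈ q then .top else .var s
  have hψσ : ψ.subst σ = ψ := by
    refine ψ.subst_eq_self fun s hs => if_neg fun hq => ?_
    rcases hψ hs with hp | hr
    · exact hpq.notMem_of_mem_left hp hq
    · exact hqr.notMem_of_mem_left hq hr
  refine ⟨φ.subst σ, φ.vars_subst_subset fun s hs => ?_, Derives.le_subst (fun s => ?_) φ, ?_⟩
  · by_cases hq : s ∈ q
    · simp [σ, hq, Fm.vars]
    · simpa [σ, hq, Fm.vars] using (hφ hs).resolve_right hq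
  · by_cases hq : s ∈ q
    · simpa [σ, hq] using Derives.le_top _
    · simpa [σ, hq] using Derives.refl _
  · have := Derives.subst σ h
    rwa [hψσ] at this

end WeakPositive

namespace ClassicalModal

variable {P : Type*} {Γ : Set (Fm P)}

/-! ### Kripke semantics -/

/-- Truth of a formula at a point of the Kripke model with relation `R` and valuation `V`. -/
def Sat {W : Type*} (R : W → W → Prop) (V : P → W → Prop) : Fm P → W → Prop
  | .var s, x => V s x
  | .bot, _ => False
  | .imp φ ψ, x => Sat R V φ x → Sat R V ψ x
  | .box φ, x => ∀ y, R x y → Sat R V φ y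

theorem sat_subst {W : Type*} (R : W → W → Prop) (V : P → W → Prop) (σ : P → Fm P) :
    ∀ (φ : Fm P) (x : W), Sat R V (φ.subst σ) x ↔ Sat R (fun s => Sat R V (σ s)) φ x
  | .var _, _ => Iff.rfl
  | .bot, _ => Iff.rfl
  | .imp φ ψ, x => imp_congr (sat_subst R V σ φ x) (sat_subst R V σ ψ x)
  | .box φ, _ => forall₂_congr fun y _ => sat_subst R V σ φ y

theorem Derives.sound {W : Type*} {R : W → W → Prop}
    (hΓ : ∀ φ ∈ Γ, ∀ V x, Sat R V φ x) {φ : Fm P} (h : Derives Γ φ) (V : P → W → Prop) (x : W) :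
    Sat R V φ x := by
  induction h generalizing V x with
  | ax h => exact hΓ _ h V x
  | subst σ _ ih => exact (sat_subst R V σ _ x).2 (ih _ x)
  | weak => exact fun h _ => h
  | distr => exact fun h h' h'' => h h'' (h' h'')
  | dne => exact not_not.1
  | mp _ _ ih ih' => exact ih V x (ih' V x)
  | boxK => exact fun h h' y hy => h y hy (h' y hy)
  | nec _ ih => exact fun y _ => ih V y

/-- K.2 is sound for confluent frames. -/
theorem sat_of_mem_K2 {W : Type*} {R : W → W → Prop}
    (hR : ∀ x y z, R x y → R x z → ∃ w, R y w ∧ R z w) {p : P} {φ : Fm P} (h : φ ∈ K2 p)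
    (V : P → W → Prop) (x : W) : Sat R V φ x := by
  refine Derives.sound ?_ h V x
  rintro _ rfl V x hx y hy hn
  refine hx fun z hz hbox => ?_
  obtain ⟨w, hyw, hzw⟩ := hR x y z hy hz
  exact hn w hyw (hbox w hzw)

/-- Formulas are invariant under bisimulations that respect their letters. -/
theorem sat_iff_of_bisimulation {W W' : Type*} {R : W → W → Prop} {R' : W' → W' → Prop}
    {V : P → W → Prop} {V' : P → W' → Prop} {Z : W → W' → Prop} {S : Set P}
    (atom : ∀ s ∈ S, ∀ x x', Z x x' → (V s x ↔ V' s x'))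
    (forth : ∀ x x', Z x x' → ∀ y, R x y → ∃ y', R' x' y' ∧ Z y y')
    (back : ∀ x x', Z x x' → ∀ y', R' x' y' → ∃ y, R x y ∧ Z y y') :
    ∀ φ ∈ Fm.formulasOver S, ∀ x x', Z x x' → (Sat R V φ x ↔ Sat R' V' φ x')
  | .var s, hφ, x, x', h => atom s (hφ rfl) x x' h
  | .bot, _, _, _, _ => Iff.rfl
  | .imp φ ψ, hφ, x, x', h => imp_congr
      (sat_iff_of_bisimulation atom forth back φ (fun _ hs => hφ (.inl hs)) x x' h)
      (sat_iff_of_bisimulation atom forth back ψ (fun _ hs => hφ (.inr hs)) x x' h)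
  | .box φ, hφ, x, x', h => by
    have ih := sat_iff_of_bisimulation atom forth back φ hφ
    constructor
    · intro hx y' hy'
      obtain ⟨y, hy, hyy'⟩ := back x x' h y' hy'
      exact (ih y y' hyy').1 (hx y hy)
    · intro hx y hy
      obtain ⟨y', hy', hyy'⟩ := forth x x' h y hy
      exact (ih y y' hyy').2 (hx y' hy')

/-! ### The canonical model -/

/-- Derivability of a formula from the theorems of `Γ` and a set of hypotheses by modus ponens. -/
inductive Entails (Γ : Set (Fm P)) (S : Set (Fm P)) : Fm P → Prop where
  | hyp {φ : Fm P} : φ ∈ S → Entails Γ S φ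
  | thm {φ : Fm P} : Derives Γ φ → Entails Γ S φ
  | mp {φ ψ : Fm P} : Entails Γ S (.imp φ ψ) → Entails Γ S φ → Entails Γ S ψ

theorem Derives.imp_self (φ : Fm P) : Derives Γ (.imp φ φ) :=
  .mp (.mp (.distr φ (.imp φ φ) φ) (.weak _ _)) (.weak φ φ)

theorem Entails.mono {S T : Set (Fm P)} (h : S ⊆ T) {φ : Fm P} (hφ : Entails Γ S φ) :
    Entails Γ T φ := by
  induction hφ with
  | hyp hs => exact .hyp (h hs)
  | thm ht => exact .thm ht
  | mp _ _ ih ih' => exact .mp ih ih'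

theorem Entails.weaken {S : Set (Fm P)} {ψ : Fm P} (φ : Fm P) (h : Entails Γ S ψ) :
    Entails Γ S (.imp φ ψ) :=
  .mp (.thm (.weak ψ φ)) h

/-- `Entails` applies necessitation and substitution to theorems only, never to hypotheses, so the
usual induction goes through. -/
theorem Entails.deduction {S : Set (Fm P)} {φ ψ : Fm P} (h : Entails Γ (insert φ S) ψ) :
    Entails Γ S (.imp φ ψ) := by
  induction h with
  | hyp hs =>
    rcases hs with rfl | hs
    · exact .thm (.imp_self _)
    · exact .weaken _ (.hyp hs)
  | thm ht => exact .weaken _ (.thm ht)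
  | mp _ _ ih ih' => exact .mp (.mp (.thm (.distr _ _ _)) ih) ih'

theorem Entails.of_empty {φ : Fm P} (h : Entails Γ ∅ φ) : Derives Γ φ := by
  induction h with
  | hyp hs => exact hs.elim
  | thm ht => exact ht
  | mp _ _ ih ih' => exact .mp ih ih'

theorem Entails.of_sUnion {c : Set (Set (Fm P))} (hc : IsChain (· ⊆ ·) c) (hne : c.Nonempty)
    {φ : Fm P} (h : Entails Γ (⋃₀ c) φ) : ∃ S ∈ c, Entails Γ S φ := by
  induction h with
  | hyp hs =>
    obtain ⟨S, hS, hs⟩ := hs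
    exact ⟨S, hS, .hyp hs⟩
  | thm ht =>
    obtain ⟨S, hS⟩ := hne
    exact ⟨S, hS, .thm ht⟩
  | mp _ _ ih ih' =>
    obtain ⟨S, hS, h⟩ := ih
    obtain ⟨T, hT, h'⟩ := ih'
    rcases hc.total hS hT with hST | hTS
    · exact ⟨T, hT, .mp (h.mono hST) h'⟩
    · exact ⟨S, hS, .mp h (h'.mono hTS)⟩

/-- The worlds of the canonical model: maximal consistent sets of formulas. -/
structure IsWorld (Γ : Set (Fm P)) (w : Set (Fm P)) : Prop where
  thm {φ : Fm P} : Derives Γ φ → φ ∈ w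
  bot : Fm.bot ∉ w
  imp (φ ψ : Fm P) : Fm.imp φ ψ ∈ w ↔ (φ ∈ w → ψ ∈ w)

/-- Lindenbaum's lemma. -/
theorem exists_isWorld {S : Set (Fm P)} (hS : ¬ Entails Γ S .bot) :
    ∃ w, IsWorld Γ w ∧ S ⊆ w := by
  obtain ⟨w, hSw, hw⟩ := zorn_subset_nonempty {T : Set (Fm P) | ¬ Entails Γ T .bot}
    (fun c hc hchain hne => ⟨⋃₀ c, fun h => by
      obtain ⟨T, hT, h⟩ := Entails.of_sUnion hchain hne h
      exact hc hT h, fun _ => Set.subset_sUnion_of_mem⟩) S hS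
  have closed {φ : Fm P} (h : Entails Γ w φ) : φ ∈ w := by
    refine hw.le_of_ge (y := insert φ w) (fun h' => hw.prop ?_) (Set.subset_insert _ _)
      (Set.mem_insert _ _)
    exact .mp h'.deduction h
  have neg_mem {φ : Fm P} (h : φ ∉ w) : Entails Γ w φ.neg := by
    by_contra hn
    refine h (hw.le_of_ge (y := insert φ w) (fun h' => hn h'.deduction) (Set.subset_insert _ _)
      (Set.mem_insert _ _))
  refine ⟨w, ⟨fun h => closed (.thm h), fun h => hw.prop (.hyp h), fun φ ψ => ⟨fun h h' =>
    closed (.mp (.hyp h) (.hyp h')), fun h => closed ?_⟩⟩, hSw⟩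
  by_cases hφ : φ ∈ w
  · exact .weaken _ (.hyp (h hφ))
  -- Here `¬φ` is entailed, so adding `φ` yields `⊥`, hence `¬¬ψ`, hence `ψ`.
  · refine .deduction (.mp (.thm (.dne ψ)) (.weaken _ ?_))
    exact .mp ((neg_mem hφ).mono (Set.subset_insert _ _)) (.hyp (Set.mem_insert _ _))

theorem IsWorld.neg {w : Set (Fm P)} (hw : IsWorld Γ w) (φ : Fm P) : φ.neg ∈ w ↔ φ ∉ w := by
  simp [Fm.neg, hw.imp, hw.bot]

/-- Besides completeness, this lets propositional tautologies be checked world by world instead of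
derived. -/
theorem derives_of_forall_isWorld {φ : Fm P} (h : ∀ w, IsWorld Γ w → φ ∈ w) : Derives Γ φ := by
  by_contra hφ
  obtain ⟨w, hw, hS⟩ := exists_isWorld (Γ := Γ) (S := {φ.neg}) fun hb => hφ <| by
    rw [← insert_empty_eq] at hb
    exact .mp (.dne φ) hb.deduction.of_empty
  exact (hw.neg φ).1 (hS rfl) (h w hw)

/-- Accessibility in the canonical model. -/
def Access (w u : Set (Fm P)) : Prop := ∀ φ, Fm.box φ ∈ w → φ ∈ u

theorem IsWorld.box_mono {w : Set (Fm P)} (hw : IsWorld Γ w) {φ ψ : Fm P}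
    (h : ∀ u, IsWorld Γ u → φ ∈ u → ψ ∈ u) (hφ : Fm.box φ ∈ w) : Fm.box ψ ∈ w := by
  have hd : Derives Γ (.imp φ ψ) := derives_of_forall_isWorld fun u hu => (hu.imp _ _).2 (h u hu)
  exact (hw.imp _ _).1 (hw.thm (.mp (.boxK φ ψ) (.nec hd))) hφ

theorem IsWorld.box_of_entails {w : Set (Fm P)} (hw : IsWorld Γ w) {φ : Fm P}
    (h : Entails Γ {ψ | Fm.box ψ ∈ w} φ) : Fm.box φ ∈ w := by
  induction h with
  | hyp hs => exact hs
  | thm ht => exact hw.thm (.nec ht)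
  | mp _ _ ih ih' => exact (hw.imp _ _).1 ((hw.imp _ _).1 (hw.thm (.boxK _ _)) ih) ih'

theorem IsWorld.box_iff {w : Set (Fm P)} (hw : IsWorld Γ w) (φ : Fm P) :
    Fm.box φ ∈ w ↔ ∀ u, IsWorld Γ u → Access w u → φ ∈ u := by
  refine ⟨fun h u _ hu => hu φ h, fun h => ?_⟩
  by_contra hφ
  obtain ⟨u, hu, hS⟩ := exists_isWorld (Γ := Γ) (S := insert φ.neg {ψ | Fm.box ψ ∈ w})
    fun hb => hφ (hw.box_of_entails (.mp (.thm (.dne φ)) hb.deduction))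
  exact (hu.neg φ).1 (hS (Set.mem_insert _ _))
    (h u hu fun ψ hψ => hS (Set.mem_insert_of_mem _ hψ))

theorem IsWorld.dia_iff {w : Set (Fm P)} (hw : IsWorld Γ w) (φ : Fm P) :
    Fm.dia φ ∈ w ↔ ∃ u, IsWorld Γ u ∧ Access w u ∧ φ ∈ u := by
  rw [Fm.dia, hw.neg, hw.box_iff]
  push Not
  refine exists_congr fun u => and_congr_right fun hu => and_congr_right fun _ => ?_
  rw [hu.neg, not_not]

/-- The hypotheses used from `v` are finitely many and collapse to one conjunction `β`; those from
`u` are absorbed under its box. For `φ = ⊥` the result is `□¬β ∈ u`, the form to which axiom .2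
applies. -/
theorem exists_box_of_entails_union {u v : Set (Fm P)} (hu : IsWorld Γ u) (hv : IsWorld Γ v)
    {φ : Fm P} (h : Entails Γ ({ψ | Fm.box ψ ∈ u} ∪ {ψ | Fm.box ψ ∈ v}) φ) :
    ∃ β, Fm.box β ∈ v ∧ Fm.box (.imp β φ) ∈ u := by
  -- Nothing is needed from `v` here, so `β` is the truth `⊥ → ⊥`.
  have of_box {φ : Fm P} (h : Fm.box φ ∈ u) : ∃ β, Fm.box β ∈ v ∧ Fm.box (.imp β φ) ∈ u :=
    ⟨.imp .bot .bot, hv.thm (.nec (.imp_self _)),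
      hu.box_mono (fun x hx hφ => (hx.imp _ _).2 fun _ => hφ) h⟩
  induction h with
  | hyp hs =>
    rcases hs with hs | hs
    · exact of_box hs
    · exact ⟨_, hs, hu.thm (.nec (.imp_self _))⟩
  | thm ht => exact of_box (hu.thm (.nec ht))
  | @mp φ ψ _ _ ih ih' =>
    obtain ⟨β, hβ, h⟩ := ih
    obtain ⟨β', hβ', h'⟩ := ih'
    have hand (x : Set (Fm P)) (hx : IsWorld Γ x) :
        Fm.neg (.imp β (.neg β')) ∈ x ↔ β ∈ x ∧ β' ∈ x := by
      simp [hx.neg, hx.imp]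
    refine ⟨.neg (.imp β (.neg β')), (hv.box_iff _).2 fun x hx hvx =>
      (hand x hx).2 ⟨hvx _ hβ, hvx _ hβ'⟩, (hu.box_iff _).2 fun x hx hux => ?_⟩
    rw [hx.imp, hand x hx]
    exact fun hb => (hx.imp _ _).1 ((hx.imp _ _).1 (hux _ h) hb.1)
      ((hx.imp _ _).1 (hux _ h') hb.2)

/-- The canonical frame of K.2 is confluent. -/
theorem Access.confluent {p : P} {Γ : Set (Fm P)}
    (hΓ : Fm.imp (.dia (.box (.var p))) (.box (.dia (.var p))) ∈ Γ)
    {w u v : Set (Fm P)} (hw : IsWorld Γ w) (hu : IsWorld Γ u)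
    (hv : IsWorld Γ v) (hwu : Access w u) (hwv : Access w v) :
    ∃ x, IsWorld Γ x ∧ Access u x ∧ Access v x := by
  by_cases h : Entails Γ ({ψ | Fm.box ψ ∈ u} ∪ {ψ | Fm.box ψ ∈ v}) .bot
  · exfalso
    obtain ⟨β, hβ, hu'⟩ := exists_box_of_entails_union hu hv h
    -- Since `□¬β ∈ u`, the world `w` contains `◇□¬β`, hence `□◇¬β`; so `◇¬β ∈ v`, against `□β ∈ v`.
    have hax : Fm.imp (.dia (.box β.neg)) (.box (.dia β.neg)) ∈ w :=
      hw.thm (.subst (fun _ => β.neg) (.ax hΓ))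
    have hdia := hwv _ ((hw.imp _ _).1 hax ((hw.dia_iff _).2 ⟨u, hu, hwu, hu'⟩))
    obtain ⟨x, hx, hvx, hn⟩ := (hv.dia_iff _).1 hdia
    exact (hx.neg β).1 hn (hvx β hβ)
  · obtain ⟨x, hx, hS⟩ := exists_isWorld h
    exact ⟨x, hx, fun φ hφ => hS (.inl hφ), fun φ hφ => hS (.inr hφ)⟩

/-- The canonical valuation. -/
theorem IsWorld.sat_iff {w : Set (Fm P)} (hw : IsWorld Γ w) (φ : Fm P) :
    φ ∈ w ↔ Sat (W := {w // IsWorld Γ w}) (fun w u => Access w.1 u.1)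
      (fun s w => .var s ∈ w.1) φ ⟨w, hw⟩ := by
  induction φ generalizing w with
  | var s => exact Iff.rfl
  | bot => exact iff_of_false hw.bot id
  | imp φ ψ ih ih' => exact (hw.imp φ ψ).trans (imp_congr (ih hw) (ih' hw))
  | box φ ih =>
    rw [hw.box_iff]
    exact ⟨fun h u hu => (ih u.2).1 (h u.1 u.2 hu), fun h u hu hwu => (ih hu).2 (h ⟨u, hu⟩ hwu)⟩

/-- K.2 is complete for confluent frames. -/
theorem mem_K2_of_sat {P : Type u} {p : P} {φ : Fm P}
    (h : ∀ (W : Type u) (R : W → W → Prop), (∀ x y z, R x y → R x z → ∃ w, R y w ∧ R z w) →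
      ∀ V x, Sat R V φ x) : φ ∈ K2 p := by
  refine derives_of_forall_isWorld fun w hw => (hw.sat_iff φ).2 (h _ _ ?_ _ _)
  intro x y z hy hz
  obtain ⟨v, hv, h₁, h₂⟩ := Access.confluent (Set.mem_singleton _) x.2 y.2 z.2 hy hz
  exact ⟨⟨v, hv⟩, h₁, h₂⟩

/-! ### Failure of interpolation -/

/-- Classical conjunction. -/
def Fm.and (φ ψ : Fm P) : Fm P := .neg (.imp φ (.neg ψ))

/-- Both `□a` and `□b` are possible, one of them holds at every successor, and `c` holds at those
points reached in two steps where `a` and `b` meet. -/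
def meeting (a b : P) (c : Fm P) : Fm P :=
  .and (.and (.dia (.box (.var a))) (.dia (.box (.var b))))
    (.and (.box (.imp (.neg (.box (.var a))) (.box (.var b))))
      (.box (.box (.imp (.var a) (.imp (.var b) c)))))

theorem sat_meeting {W : Type*} (R : W → W → Prop) (V : P → W → Prop) (a b : P) (c : Fm P)
    (x : W) : Sat R V (meeting a b c) x ↔
      ((∃ y, R x y ∧ ∀ z, R y z → V a z) ∧ (∃ y, R x y ∧ ∀ z, R y z → V b z)) ∧
      (∀ y, R x y → (∀ z, R y z → V a z) ∨ (∀ z, R y z → V b z)) ∧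
      ∀ y, R x y → ∀ z, R y z → V a z → V b z → Sat R V c z := by
  have sat_neg (φ : Fm P) (x : W) : Sat R V φ.neg x ↔ ¬ Sat R V φ x := Iff.rfl
  have sat_imp (φ ψ : Fm P) (x : W) : Sat R V (.imp φ ψ) x ↔ (Sat R V φ x → Sat R V ψ x) := Iff.rfl
  have sat_box (φ : Fm P) (x : W) : Sat R V φ.box x ↔ ∀ y, R x y → Sat R V φ y := Iff.rfl
  have sat_var (s : P) (x : W) : Sat R V (.var s) x ↔ V s x := Iff.rfl
  simp only [meeting, Fm.and, Fm.dia, sat_neg, sat_imp, sat_box, sat_var, Classical.not_imp,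
    not_not, not_forall, or_iff_not_imp_left]
  push Not
  rfl

theorem vars_meeting (a b : P) (c : Fm P) : (meeting a b c).vars ⊆ {a, b} ∪ c.vars := by
  intro s
  simp only [meeting, Fm.and, Fm.dia, Fm.neg, Fm.vars, Set.mem_union, Set.mem_singleton_iff,
    Set.mem_insert_iff, Set.mem_empty_iff_false]
  tauto

/-- Each successor carries a label `□a` or `□b` and a label `□a'` or `□b'`, and all four labels
occur. A 2×2 table with both rows and both columns occupied has an occupied diagonal or
antidiagonal, so two successors jointly carry all four labels. Their common successor satisfies both
`s` and `¬s`. -/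
theorem meeting_imp_mem_K2 {P : Type u} (p a b a' b' s : P) :
    Fm.imp (meeting a b (.var s)) (.neg (meeting a' b' (.neg (.var s)))) ∈ K2 p := by
  refine mem_K2_of_sat fun W R hR V x h h' => ?_
  rw [sat_meeting] at h h'
  obtain ⟨⟨⟨y₁, h₁, h₁'⟩, ⟨y₂, h₂, h₂'⟩⟩, hor, hs⟩ := h
  obtain ⟨⟨⟨y₃, h₃, h₃'⟩, ⟨y₄, h₄, h₄'⟩⟩, hor', hs'⟩ := h'
  have key (y z : W) (hy : R x y) (hz : R x z)
      (hab : ∀ w, R y w → R z w → (V a w ∧ V b w) ∧ V a' w ∧ V b' w) : False := by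
    obtain ⟨w, hyw, hzw⟩ := hR x y z hy hz
    obtain ⟨⟨ha, hb⟩, ha', hb'⟩ := hab w hyw hzw
    exact hs' y hy w hyw ha' hb' (hs y hy w hyw ha hb)
  -- If `y₁` and `y₂` share a primed label, the witness of the missing one is paired with whichever
  -- of them has the unprimed label it lacks.
  rcases hor' y₁ h₁ with k₁ | k₁ <;> rcases hor' y₂ h₂ with k₂ | k₂
  · rcases hor y₄ h₄ with k₄ | k₄
    · exact key y₂ y₄ h₂ h₄ fun w u v => ⟨⟨k₄ w v, h₂' w u⟩, k₂ w u, h₄' w v⟩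
    · exact key y₁ y₄ h₁ h₄ fun w u v => ⟨⟨h₁' w u, k₄ w v⟩, k₁ w u, h₄' w v⟩
  · exact key y₁ y₂ h₁ h₂ fun w u v => ⟨⟨h₁' w u, h₂' w v⟩, k₁ w u, k₂ w v⟩
  · exact key y₁ y₂ h₁ h₂ fun w u v => ⟨⟨h₁' w u, h₂' w v⟩, k₂ w v, k₁ w u⟩
  · rcases hor y₃ h₃ with k₃ | k₃
    · exact key y₂ y₃ h₂ h₃ fun w u v => ⟨⟨k₃ w v, h₂' w u⟩, h₃' w v, k₂ w u⟩
    · exact key y₁ y₃ h₁ h₃ fun w u v => ⟨⟨h₁' w u, k₃ w v⟩, h₃' w v, k₁ w u⟩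

/-- A confluent frame: the root `0` sees `1` and `2`; `1` sees `3` and `4`; `2` sees `3` and `5`;
and `3`, `4`, `5` form a cluster. -/
def diamondRel : Fin 6 → Fin 6 → Bool
  | 0, y => y = 1 ∨ y = 2
  | 1, y => y = 3 ∨ y = 4
  | 2, y => y = 3 ∨ y = 5
  | _, y => 3 ≤ y

/-- A valuation on the diamond frame: `a` is true at the successors of `1`, `b` at those of `2`,
and within the cluster `s` has the truth value `t` exactly at the point `3` where they meet. -/
def diamondVal (a b s : P) (t : Bool) (l : P) (x : Fin 6) : Prop :=
  (l = a ∧ (x = 3 ∨ x = 4)) ∨ (l = b ∧ (x = 3 ∨ x = 5)) ∨ (l = s ∧ 3 ≤ x ∧ decide (x = 3) = t)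

theorem sat_diamond_meeting {a b s : P} (hab : a ≠ b) (hsa : s ≠ a) (hsb : s ≠ b) (t : Bool)
    {c : Fm P} (hc : Sat (fun x y => diamondRel x y = true) (diamondVal a b s t) c 3) :
    Sat (fun x y => diamondRel x y = true) (diamondVal a b s t) (meeting a b c) 0 := by
  have ha (x : Fin 6) : diamondVal a b s t a x ↔ x = 3 ∨ x = 4 := by
    simp [diamondVal, hab, hsa.symm]
  have hb (x : Fin 6) : diamondVal a b s t b x ↔ x = 3 ∨ x = 5 := by
    simp [diamondVal, hab.symm, hsb.symm]
  simp only [sat_meeting, ha, hb]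
  refine ⟨⟨⟨1, by decide⟩, ⟨2, by decide⟩⟩, by decide, fun y _ z _ hz hz' => ?_⟩
  -- Only 3 satisfies both `a` and `b`, so `c` is tested there alone.
  rcases hz with rfl | rfl
  · exact hc
  · simp at hz'

theorem not_craigInterpolation_K2 {a b a' b' s : P} (hab : a ≠ b) (hab' : a' ≠ b')
    (hs : s ∉ ({a, b} : Set P)) (hs' : s ∉ ({a', b'} : Set P))
    (hd : Disjoint ({a, b} : Set P) {a', b'}) (p : P) :
    ¬ CraigInterpolation (K2 p) := by
  intro hC
  obtain ⟨χ, hχ, h, h'⟩ := hC {s} {a, b} {a', b'} (Set.disjoint_singleton_left.2 hs)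
    (Set.disjoint_singleton_left.2 hs') hd (meeting a b (.var s))
    ((vars_meeting _ _ _).trans (by simp [Fm.vars, Set.union_comm]))
    (.neg (meeting a' b' (.neg (.var s))))
    (Set.union_subset ((vars_meeting _ _ _).trans (by simp [Fm.vars, Fm.neg, Set.union_comm]))
      (Set.empty_subset _)) (meeting_imp_mem_K2 p a b a' b' s)
  simp only [Set.mem_insert_iff, Set.mem_singleton_iff, not_or] at hs hs'
  let R : Fin 6 → Fin 6 → Prop := fun x y => diamondRel x y = true
  -- `s` holds only at 3 in the first model and only at 4 and 5 in the second, so `Z` exchanges 3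
  -- with {4, 5}. Both 1 and 2 see 3 and a point of {4, 5}, so `s` cannot tell them apart.
  let Z : Fin 6 → Fin 6 → Prop := fun x y =>
    (x = 0 ∧ y = 0) ∨ ((x = 1 ∨ x = 2) ∧ (y = 1 ∨ y = 2)) ∨ (3 ≤ x ∧ 3 ≤ y ∧ (x = 3 ↔ y ≠ 3))
  have hR : ∀ x y z, R x y → R x z → ∃ w, R y w ∧ R z w := by decide
  have atom : ∀ l ∈ ({s} : Set P), ∀ x x', Z x x' →
      (diamondVal a b s true l x ↔ diamondVal a' b' s false l x') := by
    rintro _ rfl x x' hZ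
    simp only [diamondVal, hs, hs', false_and, true_and, false_or]
    revert x x'
    decide
  have forth : ∀ x x', Z x x' → ∀ y, R x y → ∃ y', R x' y' ∧ Z y y' := by decide
  have back : ∀ x x', Z x x' → ∀ y', R x' y' → ∃ y, R x y ∧ Z y y' := by decide
  have hbis := sat_iff_of_bisimulation atom forth back χ hχ 0 0 (.inl ⟨rfl, rfl⟩)
  refine sat_of_mem_K2 hR h' (diamondVal a' b' s false) 0
    (hbis.1 (sat_of_mem_K2 hR h (diamondVal a b s true) 0 ?_)) ?_
  · refine sat_diamond_meeting hab hs.1 hs.2 true ?_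
    simp [Sat, diamondVal, hs]
  · refine sat_diamond_meeting hab' hs'.1 hs'.2 false ?_
    simp [Sat, Fm.neg, diamondVal, hs']

end ClassicalModal

theorem mainTheorem4 :
    (∀ (P : Type*) (p : P) (Γ : Set WeakPositive.AxiomName),
      WeakPositive.CraigInterpolation (WeakPositive.logic (⋃ A ∈ Γ, A.pairs p))) ∧
    (∀ (P : Type*) [Infinite P] (p : P),
      ¬ ClassicalModal.CraigInterpolation (ClassicalModal.K2 p)) := by
  refine ⟨fun P p Γ => WeakPositive.craigInterpolation_logic _, fun P _ p => ?_⟩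
  let f := Infinite.natEmbedding P
  have hf : ∀ i j, f i = f j ↔ i = j := fun _ _ => f.injective.eq_iff
  refine ClassicalModal.not_craigInterpolation_K2 (a := f 0) (b := f 1) (a' := f 2) (b' := f 3)
    (s := f 4) ?_ ?_ ?_ ?_ ?_ p <;> simp [hf]
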